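/- Let $G=(\Gamma,E)$ be a fixed connected undirected graph without loops on a finite set $\Gamma$ of at least two agents, let $N_i$ be the set of neighbors of $i$, and let $\xi>0$. Let $D=\{d=(d_{ij})_{(i,j)\in\Gamma^2}:-\xi\le d_{ij}\le\xi\}$. Given $x\in\mathbb R^\Gamma$ and $d\in D$, agent $i$ measures $y_{ij}=x_j+d_{ij}$ for $j\in N_i$, chooses estimates $\tilde y_{ij}\in[y_{ij}-\xi,y_{ij}+\xi]$, $j\in N_i$, that minimize $\bigl|\sum_{j\in N_i}(\tilde y_{ij}-x_i)\bigr|$, and applies the control $u_i(x,d)=\sum_{j\in N_i}(\tilde y_{ij}-x_i)$ (which does not depend on the choice of the minimizer). Let $d:[0,\infty)\to D$ be continuous and let $x(t)$, $t\ge 0$, be a solution of $\dot x_i(t)=u_i(x(t),d(t))$, $i\in\Gamma$. Let $d^-,d^+\in D$ with $d^-\le d^+$ componentwise, let $Q=\{d\in D:d^-\le d\le d^+\}$, and let $\mu(Q,t_1,t_2)$ be the length of the longest subinterval of $[t_1,t_2]$ during which $d(t)$ remains in $Q$ ($0$ if $d(t)$ is never in $Q$ on $[t_1,t_2]$). Suppose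 that there are finite $M\ge 0$ and $\delta>0$ such that $\mu(Q,t,t+M)>\delta$ for all $t\ge 0$. Then, as $t\to\infty$, $x(t)$ converges to a point $x^*$ of the polyhedron $$P(Q,E)=\Bigl\{x\in\mathbb R^\Gamma:\ -\frac{\sum_{j\in N_i}d^+_{ij}}{|N_i|}-\xi\ \le\ \frac{\sum_{j\in N_i}x_j}{|N_i|}-x_i\ \le\ -\frac{\sum_{j\in N_i}d^-_{ij}}{|N_i|}+\xi\quad\forall i\in\Gamma\Bigr\}$$ of equilibrium points for the disturbances in $Q$; in particular, $x^*$ is an equilibrium point for some constant disturbance $q\in Q$, that is, $u_i(x^*,q)=0$ for all $i\in\Gamma$. -/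

import Mathlib

open Set Filter Topology

namespace Consensus

variable {V : Type*}

/-- The hypercube `D` of admissible disturbance vectors `d = (d i j)`, indexed by all pairs. -/
def cube (V : Type*) (ξ : ℝ) : Set (V → V → ℝ) :=
  {d | ∀ i j, -ξ ≤ d i j ∧ d i j ≤ ξ}

/-- The box `Q = {d ∈ D : dlo ≤ d ≤ dhi}`. -/
def box (ξ : ℝ) (dlo dhi : V → V → ℝ) : Set (V → V → ℝ) :=
  {d | d ∈ cube V ξ ∧ dlo ≤ d ∧ d ≤ dhi}

/-- A disturbance realization: a continuous function of time `t ≥ 0` with values in `D`. -/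
structure IsRealization (ξ : ℝ) (d : ℝ → V → V → ℝ) : Prop where
  continuousOn : ContinuousOn d (Ici 0)
  mem_cube : ∀ t, 0 ≤ t → d t ∈ cube V ξ

/-- `μ(Q, t₁, t₂)`: the length of the longest subinterval of `[t₁, t₂]` on which `d` stays in `Q`.
It is `0` if `d` is never in `Q` on `[t₁, t₂]`. -/
noncomputable def longestStay (d : ℝ → V → V → ℝ) (Q : Set (V → V → ℝ)) (t₁ t₂ : ℝ) : ℝ :=
  sSup {Δ : ℝ | 0 ≤ Δ ∧ ∃ s, t₁ ≤ s ∧ s + Δ ≤ t₂ ∧ ∀ t ∈ Icc s (s + Δ), d t ∈ Q}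

section Network

variable [Fintype V] (G : SimpleGraph V) [DecidableRel G.Adj]

/-- The information vector of agent `i`: the disturbed measures `x j + d i j` of the states of
its neighbors, and `0` in the other components. -/
def information (d : V → V → ℝ) (x : V → ℝ) (i : V) : V → ℝ :=
  fun j => if G.Adj i j then x j + d i j else 0

/-- The estimates of the neighbors' states that are compatible with the measures `y`. -/
def estimates (ξ : ℝ) (i : V) (y : V → ℝ) : Set (V → ℝ) :=
  {z | ∀ j ∈ G.neighborFinset i, z j ∈ Icc (y j - ξ) (y j + ξ)}

/-- The lazy rule: `z` minimizes `|∑ j ∈ N i, (z j - xi)|` among the compatible estimates. -/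
def IsLazyEstimate (ξ : ℝ) (i : V) (xi : ℝ) (y z : V → ℝ) : Prop :=
  z ∈ estimates G ξ i y ∧
    IsMinOn (fun w : V → ℝ => |∑ j ∈ G.neighborFinset i, (w j - xi)|) (estimates G ξ i y) z

/-- `u` is the value of the linear protocol with the lazy rule for agent `i`, in state `xi` and
with information vector `y`. -/
def IsControl (ξ : ℝ) (i : V) (xi : ℝ) (y : V → ℝ) (u : ℝ) : Prop :=
  ∃ z, IsLazyEstimate G ξ i xi y z ∧ u = ∑ j ∈ G.neighborFinset i, (z j - xi)

/-- `x` is a trajectory of the controlled system `ẋ i = u i (x i, y⁽ⁱ⁾)`, `t ≥ 0`, under the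
disturbance realization `d` (with the one-sided derivative at `t = 0`). -/
def IsTrajectory (ξ : ℝ) (d : ℝ → V → V → ℝ) (x : ℝ → V → ℝ) : Prop :=
  ∀ t, 0 ≤ t → ∀ i, ∃ u, IsControl G ξ i (x t i) (information G (d t) (x t) i) u ∧
    HasDerivWithinAt (fun s => x s i) u (Ici 0) t

/-- `p` is an equilibrium point for the disturbance realization `d`: from some time on, the
control vanishes at `p` for all agents. -/
def IsEquilibriumPoint (ξ : ℝ) (d : ℝ → V → V → ℝ) (p : V → ℝ) : Prop :=
  ∃ T, 0 ≤ T ∧ ∀ t, T ≤ t → ∀ i, IsControl G ξ i (p i) (information G (d t) p i) 0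

/-- The polyhedron `P(Q, E)` of the box `Q` with bounds `dlo` and `dhi`. -/
def polyhedron (ξ : ℝ) (dlo dhi : V → V → ℝ) : Set (V → ℝ) :=
  {x | ∀ i,
    -((∑ j ∈ G.neighborFinset i, dhi i j) / (G.degree i : ℝ)) - ξ
        ≤ (∑ j ∈ G.neighborFinset i, x j) / (G.degree i : ℝ) - x i ∧
    (∑ j ∈ G.neighborFinset i, x j) / (G.degree i : ℝ) - x i
        ≤ -((∑ j ∈ G.neighborFinset i, dlo i j) / (G.degree i : ℝ)) + ξ}

end Network

end Consensus

/-! Write `L i` for the total deviation of agent `i`. The lazy rule gives a control lying between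
`0` and `L i` (`IsControl.sq_le_mul_deviation`), and convergence uses nothing else about it.
Extremal states never spread, so there is a cluster point `p`; the Dirichlet energy decreases at
rate `4 * ∑ u i * L i`. Near `p`, an agent with `L i ≠ 0` at `p` can move only by paying energy, and
little is left above `energy G p`. The other agents drop out of the expansion `energy_sub` of
`energy G (x - p)`, which is therefore small; connectedness turns this into a bound on the distance
to `p`. So a trajectory once close enough to `p` stays close (`tendsto_of_mapClusterPt`). If the
limit violated an inequality of the polyhedron, some agent would keep a velocity bounded away from
`0` during infinitely many stays in `Q` of length `δ`, contradicting convergence. -/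

namespace Consensus

/-! ### Dirichlet energy and deviations on the graph. -/

section Laplacian

variable {V : Type*} [Fintype V] (G : SimpleGraph V) [DecidableRel G.Adj]

/-- The total deviation `∑ j ∈ N i, (x j - x i)` of the neighbors' states from that of `i`. -/
def deviation (x : V → ℝ) (i : V) : ℝ := ∑ j ∈ G.neighborFinset i, (x j - x i)

/-- The sum of `(x j - x i) ^ 2` over all ordered pairs of neighbors. -/
def energy (x : V → ℝ) : ℝ := ∑ i, ∑ j ∈ G.neighborFinset i, (x j - x i) ^ 2

lemma sum_neighbor_mul_sub (x w : V → ℝ) :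
    ∑ i, ∑ j ∈ G.neighborFinset i, (x j - x i) * (w j - w i)
      = -2 * ∑ i, w i * deviation G x i := by
  have hswap : ∑ i, ∑ j ∈ G.neighborFinset i, (x j - x i) * w j
      = ∑ i, ∑ j ∈ G.neighborFinset i, (x i - x j) * w i :=
    Finset.sum_comm' (by simp [SimpleGraph.adj_comm])
  have h1 : ∑ i, ∑ j ∈ G.neighborFinset i, (x j - x i) * (w j - w i)
      = ∑ i, ∑ j ∈ G.neighborFinset i, (x j - x i) * w j
        - ∑ i, ∑ j ∈ G.neighborFinset i, (x j - x i) * w i := by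
    simp only [← Finset.sum_sub_distrib, mul_sub]
  rw [h1, hswap, ← Finset.sum_sub_distrib, Finset.mul_sum]
  refine Finset.sum_congr rfl fun i _ => ?_
  rw [deviation, ← Finset.sum_sub_distrib, Finset.mul_sum, Finset.mul_sum]
  exact Finset.sum_congr rfl fun j _ => by ring

lemma energy_eq (x : V → ℝ) : energy G x = -2 * ∑ i, x i * deviation G x i := by
  rw [← sum_neighbor_mul_sub, energy]
  simp only [sq]

/-- Second-order expansion at `p`: the linear term sees only the agents whose deviation at `p` is
nonzero. -/
lemma energy_sub (x p : V → ℝ) :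
    energy G (x - p) = energy G x - energy G p + 4 * ∑ i, (x i - p i) * deviation G p i := by
  have h := sum_neighbor_mul_sub G p (x - p)
  have h2 : energy G x - energy G p - energy G (x - p)
      = 2 * ∑ i, ∑ j ∈ G.neighborFinset i, (p j - p i) * ((x - p) j - (x - p) i) := by
    simp only [energy, ← Finset.sum_sub_distrib, Finset.mul_sum]
    refine Finset.sum_congr rfl fun i _ => Finset.sum_congr rfl fun j _ => ?_
    simp only [Pi.sub_apply]
    ring
  simp only [Pi.sub_apply] at h h2
  linarith

lemma continuous_deviation (i : V) : Continuous fun x => deviation G x i := by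
  unfold deviation; fun_prop

lemma continuous_energy : Continuous (energy G) := by
  unfold energy; fun_prop

variable {G}

/-- Neighbors differ by at most the square root of the energy. -/
lemma abs_sub_le_sqrt_energy {i j : V} (h : G.Adj i j) (w : V → ℝ) :
    |w i - w j| ≤ √(energy G w) := by
  rw [abs_sub_comm]
  refine Real.abs_le_sqrt ?_
  refine le_trans ?_ (Finset.single_le_sum (f := fun i => ∑ j ∈ G.neighborFinset i, (w j - w i) ^ 2)
    (fun _ _ => Finset.sum_nonneg fun _ _ => sq_nonneg _) (Finset.mem_univ i))
  exact Finset.single_le_sum (f := fun j => (w j - w i) ^ 2) (fun _ _ => sq_nonneg _)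
    ((G.mem_neighborFinset i j).2 h)

lemma abs_sub_le_length_mul {i j : V} (c : G.Walk i j) (w : V → ℝ) :
    |w i - w j| ≤ c.length * √(energy G w) := by
  induction c with
  | nil => simp
  | cons h c ih =>
    rw [SimpleGraph.Walk.length_cons]
    push_cast
    have h1 := abs_sub_le_sqrt_energy h w
    have h2 := abs_sub_le (w _) (w _) (w _) |>.trans (add_le_add h1 ih)
    linarith

lemma abs_sub_le_card_mul (hG : G.Connected) (i j : V) (w : V → ℝ) :
    |w i - w j| ≤ Fintype.card V * √(energy G w) := by
  classical
  obtain ⟨c⟩ := hG.preconnected i j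
  refine (abs_sub_le_length_mul c.bypass w).trans ?_
  gcongr
  exact c.bypass_isPath.length_lt.le

end Laplacian

/-! ### Values attainable by the lazy rule. -/

section Control

variable {V : Type*} [Fintype V] {G : SimpleGraph V} [DecidableRel G.Adj] {ξ : ℝ}

lemma sum_information (d : V → V → ℝ) (x : V → ℝ) (i : V) :
    ∑ j ∈ G.neighborFinset i, (information G d x i j - x i)
      = deviation G x i + ∑ j ∈ G.neighborFinset i, d i j := by
  rw [deviation, ← Finset.sum_add_distrib]
  refine Finset.sum_congr rfl fun j hj => ?_
  rw [information, if_pos ((G.mem_neighborFinset i j).1 hj)]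
  ring

/-- Shift all measures by the same amount; the degree is positive by connectedness. -/
lemma exists_estimate [Nontrivial V] (hG : G.Connected) {i : V} {xi v : ℝ} {y : V → ℝ}
    (h : |v - ∑ j ∈ G.neighborFinset i, (y j - xi)| ≤ G.degree i * ξ) :
    ∃ z ∈ estimates G ξ i y, ∑ j ∈ G.neighborFinset i, (z j - xi) = v := by
  have hn : (0 : ℝ) < G.degree i := by exact_mod_cast hG.preconnected.degree_pos_of_nontrivial i
  set c := ∑ j ∈ G.neighborFinset i, (y j - xi) with hc
  have hb : |(v - c) / G.degree i| ≤ ξ := by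
    rw [abs_div, abs_of_pos hn, div_le_iff₀ hn]; linarith
  rw [abs_le] at hb
  refine ⟨fun j => y j + (v - c) / G.degree i, fun j _ => ⟨by linarith, by linarith⟩, ?_⟩
  have : ∑ j ∈ G.neighborFinset i, (y j + (v - c) / G.degree i - xi)
      = c + G.degree i * ((v - c) / G.degree i) := by
    rw [hc, ← SimpleGraph.card_neighborFinset_eq_degree, ← nsmul_eq_mul, ← Finset.sum_const,
      ← Finset.sum_add_distrib]
    exact Finset.sum_congr rfl fun j _ => by ring
  rw [this]
  field_simp
  ring

lemma IsControl.abs_sub_le {i : V} {xi u : ℝ} {y : V → ℝ} (h : IsControl G ξ i xi y u) :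
    |u - ∑ j ∈ G.neighborFinset i, (y j - xi)| ≤ G.degree i * ξ := by
  obtain ⟨z, ⟨hz, -⟩, rfl⟩ := h
  rw [← Finset.sum_sub_distrib, ← SimpleGraph.card_neighborFinset_eq_degree, ← nsmul_eq_mul]
  refine (Finset.abs_sum_le_sum_abs _ _).trans (Finset.sum_le_card_nsmul _ _ _ fun j hj => ?_)
  have := hz j hj
  rw [abs_le]
  constructor <;> linarith [this.1, this.2]

lemma IsControl.abs_le_abs [Nontrivial V] (hG : G.Connected) {i : V} {xi u v : ℝ} {y : V → ℝ}
    (h : IsControl G ξ i xi y u)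
    (hv : |v - ∑ j ∈ G.neighborFinset i, (y j - xi)| ≤ G.degree i * ξ) : |u| ≤ |v| := by
  obtain ⟨z, ⟨-, hmin⟩, rfl⟩ := h
  obtain ⟨w, hw, rfl⟩ := exists_estimate hG hv
  exact hmin hw

lemma isControl_zero [Nontrivial V] (hG : G.Connected) {i : V} {xi : ℝ} {y : V → ℝ}
    (h : |∑ j ∈ G.neighborFinset i, (y j - xi)| ≤ G.degree i * ξ) : IsControl G ξ i xi y 0 := by
  obtain ⟨z, hz, hsum⟩ := exists_estimate (v := 0) hG (by rwa [zero_sub, abs_neg])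
  refine ⟨z, ⟨hz, fun w _ => ?_⟩, hsum.symm⟩
  simp only [Set.mem_ofPred_eq, hsum, abs_zero]
  exact abs_nonneg _

lemma abs_sum_le_of_mem_cube {d : V → V → ℝ} (hd : d ∈ cube V ξ) (i : V) :
    |∑ j ∈ G.neighborFinset i, d i j| ≤ G.degree i * ξ := by
  rw [← SimpleGraph.card_neighborFinset_eq_degree, ← nsmul_eq_mul]
  exact (Finset.abs_sum_le_sum_abs _ _).trans
    (Finset.sum_le_card_nsmul _ _ _ fun j _ => abs_le.2 (hd i j))

/-- The control has the sign of the total deviation and does not exceed it in modulus. -/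
lemma IsControl.sq_le_mul_deviation [Nontrivial V] (hG : G.Connected) {i : V} {u : ℝ}
    {d : V → V → ℝ} (hd : d ∈ cube V ξ) {x : V → ℝ}
    (h : IsControl G ξ i (x i) (information G d x i) u) : u ^ 2 ≤ u * deviation G x i := by
  have hu := h.abs_sub_le
  have hD := abs_sum_le_of_mem_cube (G := G) hd i
  have hmin := fun v => h.abs_le_abs (v := v) hG
  rw [sum_information] at hu
  simp only [sum_information] at hmin
  -- The true states are compatible estimates, since the disturbance is at most `ξ`.
  have hL := hmin (deviation G x i) (by rw [sub_add_cancel_left, abs_neg]; exact hD)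
  rw [abs_le] at hu hD
  -- With opposite signs, `0` lies between two attainable values, so it is attainable and optimal.
  have h0 : u * deviation G x i < 0 → u = 0 := fun hneg => by
    refine abs_eq_zero.1 (le_antisymm ?_ (abs_nonneg u))
    have := hmin 0 ?_
    · simpa using this
    · rw [abs_le]
      rcases mul_neg_iff.1 hneg with ⟨h1, h2⟩ | ⟨h1, h2⟩ <;> constructor <;> linarith
  have hpos : 0 ≤ u * deviation G x i := by
    by_contra! hneg
    have := h0 hneg
    simp [this] at hneg
  rw [← abs_of_nonneg hpos, abs_mul, ← sq_abs, sq]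
  exact mul_le_mul_of_nonneg_left hL (abs_nonneg u)

end Control

/-! ### Convergence of damped flows. -/

section Dynamics

variable {V : Type*} [Fintype V] {G : SimpleGraph V} [DecidableRel G.Adj]

/-- `x` moves with velocity `u`, each component of which has the sign of the total deviation and
does not exceed it in modulus. -/
structure IsDampedFlow (G : SimpleGraph V) [DecidableRel G.Adj] (x u : ℝ → V → ℝ) : Prop where
  hasDeriv : ∀ t, 0 ≤ t → ∀ i, HasDerivWithinAt (fun s => x s i) (u t i) (Ici 0) t
  sq_le : ∀ t, 0 ≤ t → ∀ i, u t i ^ 2 ≤ u t i * deviation G (x t) i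

namespace IsDampedFlow

variable {x u : ℝ → V → ℝ}

lemma continuousOn (h : IsDampedFlow G x u) : ContinuousOn x (Ici 0) :=
  continuousOn_pi.2 fun i t ht => (h.hasDeriv t ht i).continuousWithinAt

lemma neg (h : IsDampedFlow G x u) : IsDampedFlow G (-x) (-u) where
  hasDeriv t ht i := (h.hasDeriv t ht i).neg
  sq_le t ht i := by
    have e : deviation G ((-x) t) i = -deviation G (x t) i := by
      rw [deviation, deviation, ← Finset.sum_neg_distrib]
      exact Finset.sum_congr rfl fun j _ => by simp only [Pi.neg_apply]; ring
    rw [e]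
    simpa using h.sq_le t ht i

/-- An agent at the maximum has nonpositive deviation, hence nonpositive velocity; the others stay
below for a short time by continuity. -/
lemma le_of_le [Nonempty V] (h : IsDampedFlow G x u) {m s t : ℝ} (hs : 0 ≤ s) (hst : s ≤ t)
    (hm : ∀ i, x s i ≤ m) (i : V) : x t i ≤ m := by
  let f : ℝ → ℝ := fun t => Finset.univ.sup' Finset.univ_nonempty fun i => x t i
  have hle : ∀ t i, x t i ≤ f t := fun t i =>
    Finset.le_sup' (fun i => x t i) (Finset.mem_univ i)
  have hsub : Icc s t ⊆ Ici 0 := fun r hr => hs.trans hr.1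
  have hf : ContinuousOn f (Icc s t) :=
    ContinuousOn.finset_sup'_apply Finset.univ_nonempty fun i _ =>
      (continuousOn_pi.1 h.continuousOn i).mono hsub
  refine (hle t i).trans (image_le_of_liminf_slope_right_le_deriv_boundary (B := fun _ => m)
    (B' := fun _ => 0) hf ?_ continuousOn_const
    (fun r _ => hasDerivWithinAt_const _ _ _) ?_ (right_mem_Icc.2 hst))
  · exact Finset.sup'_le _ _ fun i _ => hm i
  · intro r hr c hc
    have hr0 : 0 ≤ r := hs.trans hr.1
    have hev : ∀ i, ∀ᶠ z in 𝓝[>] r, x z i < f r + c * (z - r) := fun i => by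
      have hd : HasDerivWithinAt (fun z => x z i) (u r i) (Ioi r) r :=
        (h.hasDeriv r hr0 i).mono fun z hz => hr0.trans (le_of_lt hz)
      rcases (hle r i).lt_or_eq with hlt | heq
      · have h1 : Tendsto (fun z => x z i - (f r + c * (z - r))) (𝓝[>] r)
            (𝓝 (x r i - (f r + c * (r - r)))) :=
          hd.continuousWithinAt.tendsto.sub
            ((by fun_prop : Continuous fun z => f r + c * (z - r)).continuousWithinAt.tendsto)
        have h2 := h1.eventually_lt_const (u := 0) (by simp; exact hlt)
        filter_upwards [h2] with z hz
        linarith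
      · have hL : deviation G (x r) i ≤ 0 :=
          Finset.sum_nonpos fun j _ => by linarith [hle r j]
        have hu : u r i < c := by
          refine lt_of_le_of_lt ?_ hc
          nlinarith [h.sq_le r hr0 i]
        have h2 := (hasDerivWithinAt_iff_tendsto_slope' self_notMem_Ioi).1 hd
          |>.eventually_lt_const hu
        filter_upwards [h2, self_mem_nhdsWithin] with z hz hz'
        rw [slope_def_field, div_lt_iff₀ (sub_pos.2 hz')] at hz
        linarith
    refine Eventually.frequently ?_
    filter_upwards [eventually_all.2 hev, self_mem_nhdsWithin] with z hz hz'
    rw [slope_def_field, div_lt_iff₀ (sub_pos.2 hz')]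
    have : f z < f r + c * (z - r) := (Finset.sup'_lt_iff _).2 fun i _ => hz i
    linarith

lemma ge_of_ge [Nonempty V] (h : IsDampedFlow G x u) {m s t : ℝ} (hs : 0 ≤ s) (hst : s ≤ t)
    (hm : ∀ i, m ≤ x s i) (i : V) : m ≤ x t i := by
  have := h.neg.le_of_le (m := -m) hs hst (fun i => by simpa using hm i) i
  simpa using this

lemma exists_mapClusterPt [Nonempty V] (h : IsDampedFlow G x u) :
    ∃ p, MapClusterPt p atTop x := by
  obtain ⟨b, hb⟩ := (finite_range (x 0)).bddAbove
  obtain ⟨a, ha⟩ := (finite_range (x 0)).bddBelow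
  have hK : IsCompact (Icc (fun _ : V => a) fun _ => b) := isCompact_Icc
  obtain ⟨p, -, hp⟩ := hK.exists_mapClusterPt (f := atTop) (u := x) <| by
    refine tendsto_principal.2 ?_
    filter_upwards [eventually_ge_atTop 0] with t ht
    exact ⟨fun i => h.ge_of_ge le_rfl ht (fun i => ha ⟨i, rfl⟩) i,
      fun i => h.le_of_le le_rfl ht (fun i => hb ⟨i, rfl⟩) i⟩
  exact ⟨p, hp⟩

lemma hasDerivWithinAt_energy (h : IsDampedFlow G x u) {t : ℝ} (ht : 0 ≤ t) :
    HasDerivWithinAt (fun s => energy G (x s)) (-4 * ∑ i, u t i * deviation G (x t) i)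
      (Ici 0) t := by
  have h1 : HasDerivWithinAt (fun s => energy G (x s))
      (∑ i, ∑ j ∈ G.neighborFinset i, 2 * (x t j - x t i) * (u t j - u t i)) (Ici 0) t := by
    unfold energy
    refine HasDerivWithinAt.fun_sum fun i _ => HasDerivWithinAt.fun_sum fun j _ => ?_
    exact (((h.hasDeriv t ht j).sub (h.hasDeriv t ht i)).fun_pow 2).congr_deriv (by simp)
  refine h1.congr_deriv ?_
  have := sum_neighbor_mul_sub G (x t) (u t)
  simp only [mul_assoc, ← Finset.mul_sum]
  rw [this]
  ring

lemma mul_deviation_nonneg (h : IsDampedFlow G x u) {t : ℝ} (ht : 0 ≤ t) (i : V) :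
    0 ≤ u t i * deviation G (x t) i :=
  (sq_nonneg _).trans (h.sq_le t ht i)

/-- Where the total deviation of `k` is at least `ℓ`, moving `k` costs energy proportionally. -/
lemma mul_abs_sub_le (h : IsDampedFlow G x u) {s t ℓ : ℝ} (hs : 0 ≤ s) (hst : s ≤ t)
    (hℓ : 0 ≤ ℓ) (k : V) (hk : ∀ r ∈ Icc s t, ℓ ≤ |deviation G (x r) k|) :
    4 * ℓ * |x t k - x s k| ≤ energy G (x s) - energy G (x t) := by
  -- Both signs of `c` are needed to bound the absolute displacement.
  have key : ∀ c : ℝ, |c| = 4 * ℓ →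
      energy G (x t) + c * x t k ≤ energy G (x s) + c * x s k := by
    intro c hc
    have hder : ∀ r, 0 ≤ r → HasDerivWithinAt (fun r => energy G (x r) + c * x r k)
        (-4 * ∑ i, u r i * deviation G (x r) i + c * u r k) (Ici 0) r := fun r hr =>
      (h.hasDerivWithinAt_energy hr).add ((h.hasDeriv r hr k).const_mul c)
    have hsub : Icc s t ⊆ Ici 0 := fun r hr => hs.trans hr.1
    refine antitoneOn_of_hasDerivWithinAt_nonpos (convex_Icc s t)
      (fun r hr => (hder r (hsub hr)).continuousWithinAt.mono hsub)
      (fun r hr => (hder r (hsub (interior_subset hr))).mono (interior_subset.trans hsub))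
      (fun r hr => ?_) (left_mem_Icc.2 hst) (right_mem_Icc.2 hst) hst
    have hr' := interior_subset hr
    have hle := Finset.single_le_sum (f := fun i => u r i * deviation G (x r) i)
      (fun i _ => h.mul_deviation_nonneg (hsub hr') i) (Finset.mem_univ k)
    have hpos := h.mul_deviation_nonneg (hsub hr') k
    have habs : ℓ * |u r k| ≤ u r k * deviation G (x r) k := by
      rw [← abs_of_nonneg hpos, abs_mul, mul_comm]
      exact mul_le_mul_of_nonneg_left (hk r hr') (abs_nonneg _)
    have hcu : c * u r k ≤ 4 * (ℓ * |u r k|) := by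
      refine (le_abs_self _).trans ?_
      rw [abs_mul, hc, mul_assoc]
    linarith
  have h1 := key (4 * ℓ) (abs_of_nonneg (by positivity))
  have h2 := key (-(4 * ℓ)) (by rw [abs_neg]; exact abs_of_nonneg (by positivity))
  rcases abs_cases (x t k - x s k) with ⟨h3, -⟩ | ⟨h3, -⟩ <;> rw [h3] <;> linarith

lemma energy_le [Nonempty V] (h : IsDampedFlow G x u) {s t : ℝ} (hs : 0 ≤ s) (hst : s ≤ t) :
    energy G (x t) ≤ energy G (x s) := by
  have := h.mul_abs_sub_le hs hst le_rfl (Classical.arbitrary V) fun _ _ => abs_nonneg _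
  linarith

lemma energy_le_of_mapClusterPt [Nonempty V] (h : IsDampedFlow G x u) {p : V → ℝ}
    (hp : MapClusterPt p atTop x) {s : ℝ} (hs : 0 ≤ s) : energy G p ≤ energy G (x s) := by
  by_contra! hlt
  obtain ⟨t, ht, hst⟩ := ((hp.frequently
    ((continuous_energy G).continuousAt.eventually_const_lt hlt)).and_eventually
      (eventually_ge_atTop s)).exists
  exact absurd (h.energy_le hs hst) (not_le.2 ht)

end IsDampedFlow

/-- At the first time `b` with `f b ≥ r`, continuity gives `f b = r`, so `f ≤ r` up to `b` and the
hypothesis yields `f b < r`. -/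
lemma forall_lt_of_trapped {f : ℝ → ℝ} {s r : ℝ} (hf : ContinuousOn f (Ici s)) (hs : f s < r)
    (hr : ∀ t, s ≤ t → (∀ τ ∈ Icc s t, f τ ≤ r) → f t < r) {t : ℝ} (ht : s ≤ t) : f t < r := by
  by_contra! hlt
  have hf' : ContinuousOn f (Icc s t) := hf.mono Icc_subset_Ici_self
  have hK : IsCompact (Icc s t ∩ f ⁻¹' Ici r) :=
    isCompact_Icc.of_isClosed_subset (hf'.preimage_isClosed_of_isClosed isClosed_Icc isClosed_Ici)
      inter_subset_left
  obtain ⟨b, ⟨hb, hfb⟩, hmin⟩ := hK.exists_isLeast ⟨t, right_mem_Icc.2 ht, hlt⟩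
  refine absurd (hr b hb.1 fun τ hτ => ?_) (not_lt.2 hfb)
  have hlow : ∀ τ ∈ Icc s b, r ≤ f τ → τ = b := fun τ hτ h =>
    le_antisymm hτ.2 (hmin ⟨⟨hτ.1, hτ.2.trans hb.2⟩, h⟩)
  obtain ⟨c, hc, hfc⟩ := intermediate_value_Icc hb.1 (hf'.mono (Icc_subset_Icc_right hb.2))
    ⟨hs.le, hfb⟩
  have hcb := hlow c hc hfc.ge
  by_contra! h
  rw [hlow τ hτ h.le, ← hcb, hfc] at h
  exact lt_irrefl _ h

namespace IsDampedFlow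

variable {x u : ℝ → V → ℝ}

/-- A bound for the distance from `p` of a flow that passes through `y` and stays where the
deviations are at least half of those of `p`. The agent `k` is one with nonzero deviation at `p`. -/
lemma abs_sub_le_of_half_le [Nonempty V] (hG : G.Connected) (h : IsDampedFlow G x u) {p : V → ℝ}
    (hp : MapClusterPt p atTop x) {k : V} (hk : deviation G p k ≠ 0) {s t : ℝ} (hs : 0 ≤ s)
    (hst : s ≤ t)
    (hhalf : ∀ r ∈ Icc s t, ∀ i, |deviation G p i| / 2 ≤ |deviation G (x r) i|) {H : ℝ}
    (hH : H = energy G (x s) - energy G p + ∑ i, |deviation G p i| * |x s i - p i|) (i : V) :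
    |x t i - p i| ≤ |x s k - p k| + H / (2 * |deviation G p k|)
      + Fintype.card V * √((5 + 2 * Fintype.card V) * H) := by
  have hEs := h.energy_le_of_mapClusterPt hp hs
  have hEt := h.energy_le_of_mapClusterPt hp (hs.trans hst)
  have hEst := h.energy_le hs hst
  have hsum : 0 ≤ ∑ i, |deviation G p i| * |x s i - p i| :=
    Finset.sum_nonneg fun i _ => by positivity
  have hmove : ∀ i, |deviation G p i| * |x t i - x s i| ≤ H / 2 := fun i => by
    have := h.mul_abs_sub_le hs hst (by positivity) i fun r hr => hhalf r hr i
    linarith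
  have hdist : ∀ i, (x t i - p i) * deviation G p i
      ≤ |deviation G p i| * |x s i - p i| + H / 2 := fun i => by
    have h1 := mul_le_mul_of_nonneg_left (abs_sub_le (x t i) (x s i) (p i))
      (abs_nonneg (deviation G p i))
    have h2 := le_abs_self ((x t i - p i) * deviation G p i)
    rw [abs_mul, mul_comm] at h2
    linarith [hmove i]
  -- The energy excess is at most `H`, and the linear term at most `4 * (H + card V * H / 2)`.
  have hE : energy G (x t - p) ≤ (5 + 2 * Fintype.card V) * H := by
    rw [energy_sub]
    have := Finset.sum_le_sum fun i (_ : i ∈ Finset.univ) => hdist i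
    rw [Finset.sum_add_distrib, Finset.sum_const, Finset.card_univ, nsmul_eq_mul] at this
    linarith
  have hk' : |x t k - x s k| ≤ H / (2 * |deviation G p k|) := by
    rw [le_div_iff₀ (by positivity)]
    linarith [hmove k]
  have h1 := abs_sub_le_card_mul hG i k (x t - p)
  have h2 : Fintype.card V * √(energy G (x t - p))
      ≤ Fintype.card V * √((5 + 2 * Fintype.card V) * H) := by gcongr
  have h3 := abs_sub_le (x t k) (x s k) (p k)
  have h4 := abs_add_le ((x t - p) i - (x t - p) k) ((x t - p) k)
  simp only [Pi.sub_apply, sub_add_cancel] at h1 h4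
  linarith

lemma tendsto_of_mapClusterPt [Nonempty V] (hG : G.Connected) (h : IsDampedFlow G x u) {p : V → ℝ}
    (hp : MapClusterPt p atTop x) : Tendsto x atTop (𝓝 p) := by
  suffices ∀ r > 0, ∃ s, ∀ t, s ≤ t → dist (x t) p ≤ r by
    refine Metric.tendsto_atTop.2 fun ε hε => ?_
    obtain ⟨s, hs⟩ := this (ε / 2) (half_pos hε)
    exact ⟨s, fun t ht => (hs t ht).trans_lt (half_lt_self hε)⟩
  intro r hr
  -- Here `p` is a consensus, and monotonicity of the extremal states suffices.
  by_cases hcons : ∀ i, deviation G p i = 0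
  · have hE : energy G p = 0 := by simp [energy_eq, hcons]
    have hpp : ∀ i j, p i = p j := fun i j => by
      have := abs_sub_le_card_mul hG i j p
      rw [hE, Real.sqrt_zero, mul_zero] at this
      exact sub_eq_zero.1 (abs_eq_zero.1 (le_antisymm this (abs_nonneg _)))
    obtain ⟨s, hsr, hs⟩ := ((hp.frequently (Metric.closedBall_mem_nhds p hr)).and_eventually
      (eventually_ge_atTop 0)).exists
    have hsr' := fun i => abs_le.1 ((dist_pi_le_iff hr.le).1 hsr i)
    refine ⟨s, fun t ht => (dist_pi_le_iff hr.le).2 fun i => abs_le.2 ?_⟩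
    have h1 := h.ge_of_ge (m := p i - r) hs ht (fun j => by linarith [hpp i j, (hsr' j).1]) i
    have h2 := h.le_of_le (m := p i + r) hs ht (fun j => by linarith [hpp i j, (hsr' j).2]) i
    constructor <;> linarith
  · push Not at hcons
    obtain ⟨k, hk⟩ := hcons
    have hnear : ∀ᶠ y in 𝓝 p, ∀ i, |deviation G p i| / 2 ≤ |deviation G y i| := by
      refine eventually_all.2 fun i => ?_
      by_cases hi : deviation G p i = 0
      · exact Eventually.of_forall fun y => by rw [hi]; simp
      · exact ((continuous_deviation G i).abs.continuousAt.eventually_const_lt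
          (half_lt_self (abs_pos.2 hi))).mono fun _ => le_of_lt
    obtain ⟨ρ, hρ, hball⟩ := Metric.nhds_basis_closedBall.eventually_iff.1 hnear
    set R := min ρ r with hR
    have hR0 : 0 < R := lt_min hρ hr
    let H : (V → ℝ) → ℝ := fun y =>
      energy G y - energy G p + ∑ i, |deviation G p i| * |y i - p i|
    have hHc : Continuous H := by
      have := continuous_energy G
      fun_prop
    have hHp : H p = 0 := by simp [H]
    -- The bound of `abs_sub_le_of_half_le` as a function of the starting state; it vanishes at `p`.
    have hΨ : Continuous fun y : V → ℝ => |y k - p k| + H y / (2 * |deviation G p k|)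
        + Fintype.card V * √((5 + 2 * Fintype.card V) * H y) := by fun_prop
    have hsmall := hΨ.continuousAt (x := p) |>.eventually_lt_const (u := R)
      (by simpa [hHp] using hR0)
    obtain ⟨s, ⟨hsΨ, hsR⟩, hs⟩ := ((hp.frequently
      (hsmall.and (Metric.ball_mem_nhds p hR0))).and_eventually (eventually_ge_atTop 0)).exists
    refine ⟨s, fun t ht => le_of_lt (lt_of_lt_of_le ?_ (min_le_right ρ r))⟩
    refine forall_lt_of_trapped (f := fun t => dist (x t) p)
      ((continuous_id.dist continuous_const).comp_continuousOn
        (h.continuousOn.mono (Ici_subset_Ici.2 hs))) hsR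
      (fun t ht hτ => (dist_pi_lt_iff hR0).2 fun i => ?_) ht
    exact (h.abs_sub_le_of_half_le hG hp hk hs ht
      (fun r hr => hball ((hτ r hr).trans (min_le_left _ _))) rfl i).trans_lt hsΨ

lemma exists_tendsto [Nonempty V] (hG : G.Connected) (h : IsDampedFlow G x u) :
    ∃ p, Tendsto x atTop (𝓝 p) := by
  obtain ⟨p, hp⟩ := h.exists_mapClusterPt
  exact ⟨p, h.tendsto_of_mapClusterPt hG hp⟩

end IsDampedFlow

end Dynamics

/-! ### Locating the limit in the polyhedron. -/

section Limit

lemma exists_stay {V : Type*} {d : ℝ → V → V → ℝ} {Q : Set (V → V → ℝ)} {t₁ t₂ δ : ℝ}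
    (hδ : 0 < δ) (h : δ < longestStay d Q t₁ t₂) :
    ∃ s, t₁ ≤ s ∧ ∀ t ∈ Icc s (s + δ), d t ∈ Q := by
  unfold longestStay at h
  -- The supremum of the empty set is `0`, which `δ > 0` excludes.
  have hne : {Δ : ℝ | 0 ≤ Δ ∧ ∃ s, t₁ ≤ s ∧ s + Δ ≤ t₂ ∧ ∀ t ∈ Icc s (s + Δ), d t ∈ Q}.Nonempty := by
    rw [nonempty_iff_ne_empty]
    intro he
    rw [he, Real.sSup_empty] at h
    linarith
  obtain ⟨Δ, ⟨-, s, hs, -, hQ⟩, hΔ⟩ := exists_lt_of_lt_csSup hne h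
  exact ⟨s, hs, fun t ht => hQ t ⟨ht.1, by linarith [ht.2]⟩⟩

/-- A convergent function cannot have velocity at least `ε > 0` on arbitrarily late intervals of
length `δ > 0`. -/
lemma not_tendsto_of_deriv_ge {f f' : ℝ → ℝ} {a ε δ : ℝ} (hε : 0 < ε) (hδ : 0 < δ)
    (hf : ∀ t, 0 ≤ t → HasDerivWithinAt f (f' t) (Ici 0) t)
    (hs : ∀ T, ∃ s, T ≤ s ∧ ∀ t ∈ Icc s (s + δ), ε ≤ f' t) : ¬ Tendsto f atTop (𝓝 a) := by
  intro hlim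
  obtain ⟨T, hT⟩ := Metric.tendsto_atTop.1 hlim (ε * δ / 2) (by positivity)
  obtain ⟨s, hsT, hder⟩ := hs (max T 0)
  have hs0 : 0 ≤ s := (le_max_right _ _).trans hsT
  have hsT' : T ≤ s := (le_max_left _ _).trans hsT
  have hsub : Icc s (s + δ) ⊆ Ici 0 := fun r hr => hs0.trans hr.1
  have hmono : f s - ε * s ≤ f (s + δ) - ε * (s + δ) := by
    have hd : ∀ t, 0 ≤ t → HasDerivWithinAt (fun t => f t - ε * t) (f' t - ε) (Ici 0) t :=
      fun t ht => (hf t ht).sub (by simpa using (hasDerivWithinAt_id t (Ici 0)).const_mul ε)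
    exact monotoneOn_of_hasDerivWithinAt_nonneg (convex_Icc s (s + δ))
      (fun r hr => (hd r (hsub hr)).continuousWithinAt.mono hsub)
      (fun r hr => (hd r (hsub (interior_subset hr))).mono (interior_subset.trans hsub))
      (fun r hr => sub_nonneg.2 (hder r (interior_subset hr)))
      (left_mem_Icc.2 (by linarith)) (right_mem_Icc.2 (by linarith)) (by linarith)
  have h1 := abs_lt.1 (hT s hsT')
  have h2 := abs_lt.1 (hT (s + δ) (by linarith))
  linarith [h1.1, h2.2]

variable {V : Type*} [Fintype V] {G : SimpleGraph V} [DecidableRel G.Adj]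

lemma deviation_eq (x : V → ℝ) (i : V) :
    deviation G x i = ∑ j ∈ G.neighborFinset i, x j - G.degree i * x i := by
  rw [deviation, Finset.sum_sub_distrib, Finset.sum_const, nsmul_eq_mul,
    SimpleGraph.card_neighborFinset_eq_degree]

lemma mem_polyhedron_iff [Nontrivial V] (hG : G.Connected) {ξ : ℝ} {dlo dhi : V → V → ℝ}
    {p : V → ℝ} : p ∈ polyhedron G ξ dlo dhi ↔ ∀ i,
      -(∑ j ∈ G.neighborFinset i, dhi i j) - G.degree i * ξ ≤ deviation G p i ∧
      deviation G p i ≤ -(∑ j ∈ G.neighborFinset i, dlo i j) + G.degree i * ξ := by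
  refine forall_congr' fun i => ?_
  have hn : (0 : ℝ) < G.degree i := by exact_mod_cast hG.preconnected.degree_pos_of_nontrivial i
  rw [deviation_eq]
  refine and_congr ?_ ?_
  · rw [← mul_le_mul_iff_right₀ hn]
    refine iff_of_eq (congrArg₂ _ ?_ ?_) <;> field_simp
  · rw [← mul_le_mul_iff_right₀ hn]
    refine iff_of_eq (congrArg₂ _ ?_ ?_) <;> field_simp

lemma exists_mem_box_of_mem_polyhedron [Nontrivial V] (hG : G.Connected) {ξ : ℝ} (hξ : 0 ≤ ξ)
    {dlo dhi : V → V → ℝ} (hlo : dlo ∈ cube V ξ) (hhi : dhi ∈ cube V ξ) (hle : dlo ≤ dhi)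
    {p : V → ℝ} (hp : p ∈ polyhedron G ξ dlo dhi) :
    ∃ q ∈ box ξ dlo dhi, IsEquilibriumPoint G ξ (fun _ => q) p := by
  rw [mem_polyhedron_iff hG] at hp
  -- Row `i` of the disturbance affects only agent `i`, so each row is chosen separately on the
  -- segment from `dlo i` to `dhi i`, by the intermediate value theorem.
  have hθ : ∀ i, ∃ θ ∈ Icc (0 : ℝ) 1,
      |deviation G p i + ∑ j ∈ G.neighborFinset i, (dlo i j + θ * (dhi i j - dlo i j))|
        ≤ G.degree i * ξ := by
    intro i
    obtain ⟨h1, h2⟩ := hp i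
    have hnξ : 0 ≤ G.degree i * ξ := by positivity
    set L := deviation G p i
    set g : ℝ → ℝ := fun θ => L + ∑ j ∈ G.neighborFinset i, (dlo i j + θ * (dhi i j - dlo i j))
      with hg
    have hgc : Continuous g := by fun_prop
    have g0 : g 0 = L + ∑ j ∈ G.neighborFinset i, dlo i j := by simp [hg]
    have g1 : g 1 = L + ∑ j ∈ G.neighborFinset i, dhi i j := by simp [hg]
    by_cases hb : -(G.degree i * ξ) ≤ g 0
    · exact ⟨0, by simp, abs_le.2 ⟨hb, show g 0 ≤ _ by linarith⟩⟩
    · obtain ⟨θ, hθ, hgθ⟩ := intermediate_value_Icc zero_le_one hgc.continuousOn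
        (show -(G.degree i * ξ) ∈ Icc (g 0) (g 1) from ⟨by linarith, by linarith⟩)
      exact ⟨θ, hθ, abs_le.2 ⟨hgθ.ge, show g θ ≤ _ by linarith⟩⟩
  choose θ hθ hsum using hθ
  have hqlo : ∀ i j, dlo i j ≤ dlo i j + θ i * (dhi i j - dlo i j) := fun i j => by
    have := mul_nonneg (hθ i).1 (sub_nonneg.2 (hle i j))
    linarith
  have hqhi : ∀ i j, dlo i j + θ i * (dhi i j - dlo i j) ≤ dhi i j := fun i j => by
    have := mul_le_mul_of_nonneg_right (hθ i).2 (sub_nonneg.2 (hle i j))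
    linarith
  refine ⟨fun i j => dlo i j + θ i * (dhi i j - dlo i j),
    ⟨fun i j => ⟨(hlo i j).1.trans (hqlo i j), (hqhi i j).trans (hhi i j).2⟩, hqlo, hqhi⟩,
    0, le_rfl, fun t _ i => isControl_zero hG ?_⟩
  rw [sum_information]
  exact hsum i

end Limit

end Consensus

open Consensus in
theorem theorem2 {V : Type*} [Fintype V] [Nontrivial V]
    (G : SimpleGraph V) [DecidableRel G.Adj] (hG : G.Connected)
    (ξ : ℝ) (hξ : 0 < ξ)
    (d : ℝ → V → V → ℝ) (hd : Consensus.IsRealization ξ d)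
    (dlo dhi : V → V → ℝ) (hlo : dlo ∈ Consensus.cube V ξ) (hhi : dhi ∈ Consensus.cube V ξ)
    (hle : dlo ≤ dhi)
    (M δ : ℝ) (hM : 0 ≤ M) (hδ : 0 < δ)
    (hμ : ∀ t, 0 ≤ t → δ < Consensus.longestStay d (Consensus.box ξ dlo dhi) t (t + M))
    (x : ℝ → V → ℝ) (hx : Consensus.IsTrajectory G ξ d x) :
    ∃ p : V → ℝ, Tendsto x atTop (𝓝 p) ∧
      p ∈ Consensus.polyhedron G ξ dlo dhi ∧
      ∃ q ∈ Consensus.box ξ dlo dhi, Consensus.IsEquilibriumPoint G ξ (fun _ => q) p := by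
  choose! u hu hder using hx
  have hflow : IsDampedFlow G x u :=
    ⟨hder, fun t ht i => (hu t ht i).sq_le_mul_deviation hG (hd.mem_cube t ht)⟩
  obtain ⟨p, hp⟩ := hflow.exists_tendsto hG
  have hstay : ∀ T, ∃ s, max T 0 ≤ s ∧ ∀ t ∈ Icc s (s + δ), d t ∈ box ξ dlo dhi := fun T =>
    exists_stay hδ (hμ _ (le_max_right T 0))
  have hpi := tendsto_pi_nhds.1 hp
  have hdev : ∀ i, Tendsto (fun t => deviation G (x t) i) atTop (𝓝 (deviation G p i)) := fun i =>
    ((continuous_deviation G i).tendsto p).comp hp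
  have hctl : ∀ t, 0 ≤ t → ∀ i,
      |u t i - (deviation G (x t) i + ∑ j ∈ G.neighborFinset i, d t i j)| ≤ G.degree i * ξ :=
    fun t ht i => by simpa only [sum_information] using (hu t ht i).abs_sub_le
  have hpoly : p ∈ polyhedron G ξ dlo dhi := by
    refine (mem_polyhedron_iff hG).2 fun i => ⟨?_, ?_⟩
    · by_contra! hlt
      -- `c` separates the limit deviation from the violated bound; the gap from `c` to that bound
      -- is the minimal speed during late stays in the box.
      obtain ⟨c, hc, hc'⟩ := exists_between hlt
      obtain ⟨T, hT⟩ := eventually_atTop.1 ((hdev i).eventually_lt_const hc)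
      refine not_tendsto_of_deriv_ge (sub_pos.2 hc') hδ (fun t ht => (hder t ht i).neg)
        (fun T' => ?_) (hpi i).neg
      obtain ⟨s, hs, hQ⟩ := hstay (max T T')
      simp only [max_le_iff] at hs
      refine ⟨s, hs.1.2, fun t ht => ?_⟩
      have h1 := (abs_le.1 (hctl t (hs.2.trans ht.1) i)).2
      have h2 := hT t (hs.1.1.trans ht.1)
      have h3 : ∑ j ∈ G.neighborFinset i, d t i j ≤ ∑ j ∈ G.neighborFinset i, dhi i j :=
        Finset.sum_le_sum fun j _ => (hQ t ht).2.2 i j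
      linarith
    · by_contra! hlt
      obtain ⟨c, hc, hc'⟩ := exists_between hlt
      obtain ⟨T, hT⟩ := eventually_atTop.1 ((hdev i).eventually_const_lt hc')
      refine not_tendsto_of_deriv_ge (sub_pos.2 hc) hδ (fun t ht => hder t ht i)
        (fun T' => ?_) (hpi i)
      obtain ⟨s, hs, hQ⟩ := hstay (max T T')
      simp only [max_le_iff] at hs
      refine ⟨s, hs.1.2, fun t ht => ?_⟩
      have h1 := (abs_le.1 (hctl t (hs.2.trans ht.1) i)).1
      have h2 := hT t (hs.1.1.trans ht.1)
      have h3 : ∑ j ∈ G.neighborFinset i, dlo i j ≤ ∑ j ∈ G.neighborFinset i, d t i j :=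
        Finset.sum_le_sum fun j _ => (hQ t ht).2.1 i j
      linarith
  exact ⟨p, hp, hpoly, exists_mem_box_of_mem_polyhedron hG hξ.le hlo hhi hle hpoly⟩
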